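/- Let $(W,S)$ be a Coxeter system with $W$ finite, with length function $\ell$, and let $\Delta$ be a thick building of type $(W,S)$ (not necessarily irreducible) with Weyl distance $\delta$, regarded as a simplicial complex whose simplices have types $J\subseteq S$. Chambers are opposite if they are at maximal distance in the chamber graph; simplices $\alpha,\beta$ are opposite if each chamber containing $\alpha$ is opposite some chamber containing $\beta$, and conversely. Let $\theta$ be an automorphism of the simplicial complex $\Delta$ (not necessarily type preserving), write $\sigma^\theta$ for the image of a simplex $\sigma$, and let $\mathrm{Opp}(\theta)$ be the set of simplices $\sigma$ that are opposite $\sigma^\theta$. Let $J=\mathrm{Type}(\theta)$ be the union of all $J'\subseteq S$ such that $\mathrm{Opp}(\theta)$ contains a simplex of type $J'$, and suppose that $\theta$ is capped, that is, $\mathrm{Opp}(\theta)$ contains a simplex of type $J$. Let $\mathrm{disp}(\theta)$ be the maximum of the gallery distance between $C$ and $C^\theta$ over all chambers $C$. For $K\subseteq S$ let $W_K$ be the subgroup generated by $K$ and $w_K$ its longest element, let $w_0=w_S$, and let $\mathrm{diam}(W_K)$ be the diameter of the Cayley graph of $W_K$ with respect to $K$. Then this maximum is attained and $$\mathrm{disp}(\theta)=\mathrm{diam}(W)-\mathrm{diam}(W_{S\setminus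 J})=\ell(w_0)-\ell(w_{S\setminus J}).$$ Moreover, a chamber $C$ attains the maximal displacement (that is, the gallery distance between $C$ and $C^\theta$, equivalently $\ell(\delta(C,C^\theta))$, equals $\mathrm{disp}(\theta)$) if and only if $\delta(C,C^\theta)=w_{S\setminus J}\,w_0$. -/

import Mathlib

/-! ### Parabolic subgroups, longest elements, diameters -/

namespace CoxeterSystem

variable {B W : Type*} [Group W] {M : CoxeterMatrix B} (cs : CoxeterSystem M W)

/-- The standard parabolic subgroup `W_K` generated by the simple reflections indexed by `K`. -/
def parabolic (K : Set B) : Subgroup W :=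
  Subgroup.closure (cs.simple '' K)

/-- `w` is an element of maximal length of the parabolic subgroup `W_K`. -/
def IsLongestIn (K : Set B) (w : W) : Prop :=
  w ∈ cs.parabolic K ∧ ∀ u ∈ cs.parabolic K, cs.length u ≤ cs.length w

theorem exists_isLongestIn [Finite W] (K : Set B) : ∃ w, cs.IsLongestIn K w := by
  obtain ⟨w, hw, h⟩ := Set.exists_max_image (cs.parabolic K : Set W) cs.length
    (Set.toFinite _) ⟨1, (cs.parabolic K).one_mem⟩
  exact ⟨w, hw, h⟩

/-- The longest element `w_K` of `W_K`, for a finite Coxeter group `W`; in particular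
`longest Set.univ` is the longest element `w₀` of `W`. -/
noncomputable def longest [Finite W] (K : Set B) : W :=
  (cs.exists_isLongestIn K).choose

/-- The diameter of `W`: the diameter of its Cayley graph with respect to all simple reflections. -/
noncomputable def diam : ℕ :=
  (SimpleGraph.mulCayley (Set.range cs.simple)).diam

/-- The diameter of `W_K`: the diameter of the Cayley graph of the group `W_K` with respect to
the simple reflections indexed by `K`. -/
noncomputable def parabolicDiam (K : Set B) : ℕ :=
  (SimpleGraph.mulCayley {g : cs.parabolic K | ∃ i ∈ K, (g : W) = cs.simple i}).diam

end CoxeterSystem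

/-! ### Buildings -/

/-- A building of type `(W, S)`, given by its set `C` of chambers and its Weyl distance function
`δ : C × C → W`. Its simplices are the residues, see `Building.Simplex`. -/
structure Building {B W : Type*} [Group W] {M : CoxeterMatrix B} (cs : CoxeterSystem M W)
    (C : Type*) where
  /-- There is at least one chamber. -/
  nonempty : Nonempty C
  /-- The Weyl distance. -/
  δ : C → C → W
  δ_eq_one_iff : ∀ x y, δ x y = 1 ↔ x = y
  δ_of_adj : ∀ (x' x y : C) (i : B), δ x' x = cs.simple i →
    δ x' y = cs.simple i * δ x y ∨ δ x' y = δ x y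
  δ_of_adj_of_length : ∀ (x' x y : C) (i : B), δ x' x = cs.simple i →
    cs.length (cs.simple i * δ x y) = cs.length (δ x y) + 1 → δ x' y = cs.simple i * δ x y
  exists_adj : ∀ (x y : C) (i : B), ∃ x', δ x' x = cs.simple i ∧ δ x' y = cs.simple i * δ x y

namespace Building

variable {B W : Type*} [Group W] {M : CoxeterMatrix B} {cs : CoxeterSystem M W} {C : Type*}
  (Δ : Building cs C)

/-- The residue of type `K` (the `K`-residue) of the chamber `x`. -/
def residue (K : Set B) (x : C) : Set C :=
  {y | Δ.δ x y ∈ cs.parabolic K}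

/-- The simplices of the building: a simplex is identified with the set of all chambers that
contain it, and these sets are exactly the residues. The `K`-residues are the simplices of type
`S ∖ K`; the singletons are the chambers, and the set of all chambers is the empty simplex. -/
structure Simplex where
  /-- The set of chambers containing the simplex. -/
  chambers : Set C
  isResidue : ∃ (K : Set B) (x : C), chambers = Δ.residue K x

theorem Simplex.chambers_injective :
    Function.Injective (fun σ : Δ.Simplex => OrderDual.toDual σ.chambers) := by
  rintro ⟨s, hs⟩ ⟨t, ht⟩ h
  cases h
  rfl

/-- The face relation of the simplicial complex: `σ ≤ τ` means that every chamber containing `τ`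
contains `σ`. -/
instance : PartialOrder Δ.Simplex :=
  PartialOrder.lift (fun σ : Δ.Simplex => OrderDual.toDual σ.chambers)
    (Simplex.chambers_injective Δ)

variable {Δ}

theorem Simplex.le_iff {σ τ : Δ.Simplex} : σ ≤ τ ↔ τ.chambers ⊆ σ.chambers := Iff.rfl

/-- The simplex `σ` has type `J`. -/
def Simplex.HasType (σ : Δ.Simplex) (J : Set B) : Prop :=
  ∃ x, σ.chambers = Δ.residue Jᶜ x

variable (Δ)

theorem residue_empty (x : C) : Δ.residue ∅ x = {x} := by
  ext y
  simp only [residue, CoxeterSystem.parabolic, Set.image_empty, Subgroup.closure_empty,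
    Subgroup.mem_bot, Set.mem_ofPred_eq, Set.mem_singleton_iff, Δ.δ_eq_one_iff]
  exact eq_comm

/-- A chamber, regarded as a simplex. -/
def chamber (x : C) : Δ.Simplex :=
  ⟨{x}, ∅, x, (Δ.residue_empty x).symm⟩

variable {Δ}

theorem Simplex.chambers_nonempty (σ : Δ.Simplex) : σ.chambers.Nonempty := by
  obtain ⟨s, K, x, rfl⟩ := σ
  refine ⟨x, ?_⟩
  have h : Δ.δ x x = 1 := (Δ.δ_eq_one_iff x x).2 rfl
  simp [residue, h, (cs.parabolic K).one_mem]

theorem Simplex.le_chamber_iff {σ : Δ.Simplex} {x : C} :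
    σ ≤ Δ.chamber x ↔ x ∈ σ.chambers := by
  rw [Simplex.le_iff]
  exact Set.singleton_subset_iff

theorem chamber_isMax (x : C) : IsMax (Δ.chamber x) := by
  intro σ h
  obtain ⟨y, hy⟩ := σ.chambers_nonempty
  have hyx : y = x := Simplex.le_iff.1 h hy
  subst hyx
  exact Simplex.le_chamber_iff.2 hy

theorem exists_eq_chamber_of_isMax {σ : Δ.Simplex} (h : IsMax σ) : ∃ x, σ = Δ.chamber x := by
  obtain ⟨x, hx⟩ := σ.chambers_nonempty
  exact ⟨x, le_antisymm (Simplex.le_chamber_iff.2 hx) (h (Simplex.le_chamber_iff.2 hx))⟩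

variable (Δ)

/-- The building is thick: every panel is contained in at least three chambers. -/
def IsThick : Prop :=
  ∀ (x : C) (i : B), ∃ y z, y ≠ z ∧ Δ.δ x y = cs.simple i ∧ Δ.δ x z = cs.simple i

/-- The chamber graph: two distinct chambers are adjacent if they have a common panel, that is, a
common simplex of type `S ∖ {s}` for some `s ∈ S`. -/
def chamberGraph : SimpleGraph C where
  Adj x y := x ≠ y ∧ ∃ (i : B) (σ : Δ.Simplex),
    σ.HasType {i}ᶜ ∧ x ∈ σ.chambers ∧ y ∈ σ.chambers
  symm := ⟨fun _ _ ⟨h, i, σ, hσ, hx, hy⟩ => ⟨h.symm, i, σ, hσ, hy, hx⟩⟩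
  loopless := ⟨fun _ h => h.1 rfl⟩

/-- The gallery distance between two chambers. -/
noncomputable def galleryDist (x y : C) : ℕ :=
  Δ.chamberGraph.dist x y

/-- Two chambers are opposite if they are at maximal distance in the chamber graph. -/
def OppositeChambers (x y : C) : Prop :=
  ∀ x' y', Δ.galleryDist x' y' ≤ Δ.galleryDist x y

variable {Δ}

/-- Opposite simplices. -/
def Opposite (α β : Δ.Simplex) : Prop :=
  (∀ x ∈ α.chambers, ∃ y ∈ β.chambers, Δ.OppositeChambers x y) ∧
    ∀ y ∈ β.chambers, ∃ x ∈ α.chambers, Δ.OppositeChambers x y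

variable (Δ)

/-- An automorphism of the simplicial complex; it need not preserve types. -/
abbrev Automorphism := Δ.Simplex ≃o Δ.Simplex

namespace Automorphism

variable {Δ} (θ : Δ.Automorphism)

theorem exists_apply_chamber (x : C) : ∃ y, θ (Δ.chamber x) = Δ.chamber y :=
  exists_eq_chamber_of_isMax ((OrderIso.isMax_apply θ).2 (chamber_isMax x))

/-- The image of a chamber under an automorphism, as a chamber. -/
noncomputable def onChamber (x : C) : C :=
  (exists_apply_chamber θ x).choose

theorem apply_chamber (x : C) : θ (Δ.chamber x) = Δ.chamber (onChamber θ x) :=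
  (exists_apply_chamber θ x).choose_spec

/-- The simplices that are opposite to their image. -/
def Opp : Set Δ.Simplex :=
  {σ | Opposite σ (θ σ)}

/-- The type of `θ`: the union of all `J` such that `Opp θ` contains a simplex of type `J`. -/
def type : Set B :=
  ⋃₀ {J | ∃ σ ∈ Opp θ, σ.HasType J}

/-- `θ` is capped if `Opp θ` contains a simplex whose type is the type of `θ`. -/
def IsCapped : Prop :=
  ∃ σ ∈ Opp θ, σ.HasType (type θ)

/-- The displacement of `θ`: the maximal gallery distance between a chamber and its image. -/
noncomputable def disp : ℕ :=
  ⨆ x, Δ.galleryDist x (onChamber θ x)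

end Automorphism

end Building

/-! Let `x` be displaced maximally, by `w`, and let `K` be the set of left ascents of `w`. If `i ∈
K` and `y` is `i`-adjacent to `x`, maximality forces `δ(y, yθ) = sᵢ w sⱼ` for some `j`; comparing
two such chambers, which thickness provides, forces `sᵢ w = w sⱼ`
(`IsMaxDisplaced.exists_of_not_isLeftDescent`). So `w` displaces every chamber of the `K`-residue of
`x`.

Lengths add in `w_K w`, since `w` has no left descent in `K`. Moving `w_K` through `w` also writes
this product as `w v` with `v` no longer than `w_K`, so left descents of `w` survive in it; the
elements of `K` are descents because of `w_K`. An element having all left descents is `w₀`, hence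
`w_K w = w₀` (`IsMaxDisplaced.longest_mul`), and the `K`-residue is opposite its image
(`IsMaxDisplaced.mem_Opp`). Therefore `S ∖ K ⊆ J`.

Conversely, a simplex of type `J` in `Opp θ` gives `ℓ(w₀) ≤ ℓ(w) + ℓ(w_{S∖J})` by the triangle
inequality (`longest_univ_le_of_mem_Opp`). Together with `S ∖ J ⊆ K` this yields `w_{S∖J} = w_K`, so
`w = w_{S∖J} w₀`. The Coxeter group input is the exchange condition. -/

namespace CoxeterSystem

variable {B W : Type*} [Group W] {M : CoxeterMatrix B} (cs : CoxeterSystem M W)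

/-! ### The exchange condition -/

open Classical in
/-- The action of a simple reflection on `W × ℤ/2` that flips the sign of the reflection itself. -/
noncomputable def signedConj (i : B) : Function.End (W × ZMod 2) := fun p =>
  (cs.simple i * p.1 * cs.simple i, p.2 + if p.1 = cs.simple i then 1 else 0)

open Classical in
-- Each factor contributes one sign test; pulled back to `t`, the tests compare it with the
-- successive elements `r⁻ˡ sⱼ`, where `r = sᵢ sⱼ`.
theorem signedConj_mul_pow (i j : B) (n : ℕ) (t : W) (e : ZMod 2) :
    ((cs.signedConj i * cs.signedConj j) ^ n) (t, e) =
      ((cs.simple i * cs.simple j) ^ n * t * ((cs.simple i * cs.simple j) ^ n)⁻¹,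
        e + ∑ l ∈ Finset.range (2 * n),
          if t = ((cs.simple i * cs.simple j) ^ l)⁻¹ * cs.simple j then 1 else 0) := by
  set r := cs.simple i * cs.simple j with hr
  have hrj : ∀ n : ℕ, cs.simple j * r ^ n = (r ^ n)⁻¹ * cs.simple j := by
    intro n
    induction n with
    | zero => simp
    | succ n ih =>
      have h1 : cs.simple j * r = r⁻¹ * cs.simple j := by simp [hr, mul_assoc]
      rw [pow_succ', ← mul_assoc, h1, mul_assoc, ih, ← mul_assoc, ← mul_inv_rev, ← pow_succ,
        pow_succ']
  induction n with
  | zero =>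
    change (t, e) = _
    simp
  | succ n ih =>
    rw [pow_succ']
    change (cs.signedConj i * cs.signedConj j) (((cs.signedConj i * cs.signedConj j) ^ n) (t, e)) = _
    rw [ih]
    change cs.signedConj i (cs.signedConj j _) = _
    have h1 : r ^ n * t * (r ^ n)⁻¹ = cs.simple j ↔ t = (r ^ (2 * n))⁻¹ * cs.simple j := by
      rw [mul_inv_eq_iff_eq_mul, hrj, ← eq_inv_mul_iff_mul_eq, two_mul, pow_add, mul_inv_rev,
        mul_assoc]
    have h2 : cs.simple j * (r ^ n * t * (r ^ n)⁻¹) * cs.simple j = cs.simple i ↔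
        t = (r ^ (2 * n + 1))⁻¹ * cs.simple j := by
      have : cs.simple j * (r ^ n * t * (r ^ n)⁻¹) * cs.simple j = cs.simple i ↔
          r ^ n * t * (r ^ n)⁻¹ = r⁻¹ * cs.simple j := by
        constructor
        · intro h
          have h' : r⁻¹ * cs.simple j = cs.simple j * cs.simple i * cs.simple j := by simp [hr]
          rw [h', ← h]
          simp [mul_assoc]
        · intro h
          rw [h]
          simp [hr, mul_assoc]
      rw [this, mul_inv_eq_iff_eq_mul, mul_assoc, hrj, ← eq_inv_mul_iff_mul_eq]
      have h3 : (r ^ (2 * n + 1))⁻¹ = (r ^ n)⁻¹ * (r⁻¹ * (r ^ n)⁻¹) := by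
        rw [← mul_inv_rev, ← mul_inv_rev, ← pow_succ, ← pow_add]
        congr 2
        omega
      rw [h3, mul_assoc, mul_assoc]
    simp only [signedConj, h1, h2]
    rw [show 2 * (n + 1) = 2 * n + 1 + 1 by ring, Finset.sum_range_succ, Finset.sum_range_succ]
    refine Prod.ext ?_ ?_
    · simp [hr, pow_succ', mul_assoc]
    · simp only [add_assoc]

theorem isLiftable_signedConj : M.IsLiftable cs.signedConj := by
  classical
  intro i j
  funext ⟨t, e⟩
  -- Since `(sᵢ sⱼ) ^ M i j = 1`, the two halves of the sum agree and cancel modulo 2.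
  rw [signedConj_mul_pow, two_mul, Finset.sum_range_add, simple_mul_simple_pow]
  change _ = (t, e)
  simp [pow_add, CharTwo.add_self_eq_zero]

/-- The homomorphism extending `signedConj`. -/
noncomputable def signedConjHom : W →* Function.End (W × ZMod 2) :=
  cs.lift ⟨cs.signedConj, cs.isLiftable_signedConj⟩

open Classical in
-- The left side depends only on the product of `ω`, so the parity with which `t` occurs in the
-- right inversion sequence does too.
theorem signedConjHom_wordProd (ω : List B) (t : W) (e : ZMod 2) :
    cs.signedConjHom (cs.wordProd ω) (t, e) =
      (cs.wordProd ω * t * (cs.wordProd ω)⁻¹, e + ((cs.rightInvSeq ω).count t : ℕ)) := by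
  induction ω with
  | nil =>
    rw [wordProd_nil, map_one]
    change (t, e) = _
    simp
  | cons i ω ih =>
    rw [wordProd_cons, map_mul]
    change cs.signedConjHom _ (cs.signedConjHom _ (t, e)) = _
    rw [ih, signedConjHom, lift_apply_simple]
    simp only [signedConj, rightInvSeq, List.count_cons, beq_iff_eq]
    have h : cs.wordProd ω * t * (cs.wordProd ω)⁻¹ = cs.simple i ↔
        (cs.wordProd ω)⁻¹ * cs.simple i * cs.wordProd ω = t := by
      rw [mul_inv_eq_iff_eq_mul, mul_assoc, inv_mul_eq_iff_eq_mul, eq_comm]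
    refine Prod.ext ?_ ?_
    · simp [mul_assoc]
    · simp only [h]
      push_cast
      rw [add_assoc]

theorem simple_mem_rightInvSeq {ω : List B} {i : B} (h : cs.IsRightDescent (cs.wordProd ω) i) :
    cs.simple i ∈ cs.rightInvSeq ω := by
  classical
  by_contra hn
  -- If `sᵢ` were missing for `ω`, the extra sign flip would make it occur for a reduced word `ω'`
  -- of `w sᵢ`; then `w sᵢ` would be longer than `w`.
  obtain ⟨ω', hω', hw⟩ := cs.exists_isReduced (cs.wordProd ω * cs.simple i)
  have h1 := cs.signedConjHom_wordProd ω (cs.simple i) 1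
  rw [List.count_eq_zero_of_not_mem hn] at h1
  have h2 := cs.signedConjHom_wordProd ω' (cs.simple i) 0
  rw [← hw, map_mul] at h2
  change cs.signedConjHom _ (cs.signedConjHom (cs.simple i) _) = _ at h2
  have h3 : cs.signedConjHom (cs.simple i) (cs.simple i, 0) = (cs.simple i, 1) := by
    rw [signedConjHom, lift_apply_simple]
    simp [signedConj]
  rw [h3, h1] at h2
  have h4 : cs.simple i ∈ cs.rightInvSeq ω' := by
    by_contra hn'
    rw [List.count_eq_zero_of_not_mem hn'] at h2
    simpa using congrArg Prod.snd h2
  have h5 := (cs.isRightInversion_of_mem_rightInvSeq hω' h4).2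
  rw [← hw, simple_mul_simple_cancel_right] at h5
  exact absurd h (not_lt.2 h5.le)

/-- The exchange condition. -/
theorem exists_eraseIdx_of_isRightDescent {ω : List B} {i : B}
    (h : cs.IsRightDescent (cs.wordProd ω) i) :
    ∃ j < ω.length, cs.wordProd ω * cs.simple i = cs.wordProd (ω.eraseIdx j) := by
  obtain ⟨j, hj, hji⟩ := List.getElem_of_mem (cs.simple_mem_rightInvSeq h)
  refine ⟨j, by simpa using hj, ?_⟩
  rw [← wordProd_mul_getD_rightInvSeq, List.getD_eq_getElem _ _ hj, hji]

/-- The exchange condition for a product of two elements. -/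
theorem exists_mul_simple_eq {u v : W} {i : B}
    (h : cs.length (v * u * cs.simple i) < cs.length (v * u))
    (hu : cs.length u < cs.length (u * cs.simple i)) :
    ∃ v', v * u * cs.simple i = v' * u ∧ cs.length v' < cs.length v := by
  obtain ⟨ω, hω, rfl⟩ := cs.exists_isReduced u
  obtain ⟨η, hη, rfl⟩ := cs.exists_isReduced v
  rw [← wordProd_append] at h
  obtain ⟨j, hj, hji⟩ := cs.exists_eraseIdx_of_isRightDescent h
  rw [List.length_append] at hj
  rcases lt_or_ge j η.length with hjη | hjη
  · refine ⟨cs.wordProd (η.eraseIdx j), ?_, ?_⟩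
    · rw [← wordProd_append, hji, List.eraseIdx_append_of_lt_length hjη, wordProd_append]
    · rw [hη.eq]
      refine (cs.length_wordProd_le _).trans_lt ?_
      rw [List.length_eraseIdx_of_lt hjη]
      omega
  -- A letter deleted from the word of `u` would make `u sᵢ` shorter than `u`, contrary to `hu`.
  · rw [List.eraseIdx_append_of_length_le hjη, wordProd_append, wordProd_append, mul_assoc,
      mul_right_inj] at hji
    rw [hji, hω.eq] at hu
    have h1 := cs.length_wordProd_le (ω.eraseIdx (j - η.length))
    rw [List.length_eraseIdx_of_lt (by omega)] at h1
    omega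

theorem exists_simple_mul_eq {u v : W} {i : B}
    (h : cs.length (cs.simple i * (u * v)) < cs.length (u * v))
    (hu : cs.length u < cs.length (cs.simple i * u)) :
    ∃ v', cs.simple i * (u * v) = u * v' ∧ cs.length v' < cs.length v := by
  have h1 : ∀ x y : W, cs.length (x⁻¹ * y⁻¹) = cs.length (y * x) := fun x y => by
    rw [← mul_inv_rev, length_inv]
  obtain ⟨v', hv', hl⟩ := cs.exists_mul_simple_eq (u := u⁻¹) (v := v⁻¹) (i := i)
    (by rw [← mul_inv_rev, ← cs.inv_simple i, h1, length_inv]; simpa using h)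
    (by rw [← cs.inv_simple i, h1, length_inv]; exact hu)
  refine ⟨v'⁻¹, ?_, by simpa using hl⟩
  have := congrArg (·⁻¹) hv'
  simpa [mul_assoc] using this

/-! ### Parabolic subgroups -/

variable {cs} in
theorem simple_mem_parabolic {K : Set B} {i : B} (hi : i ∈ K) : cs.simple i ∈ cs.parabolic K :=
  Subgroup.subset_closure ⟨i, hi, rfl⟩

theorem parabolic_mono {K L : Set B} (h : K ⊆ L) : cs.parabolic K ≤ cs.parabolic L :=
  Subgroup.closure_mono (Set.image_mono h)

theorem mem_parabolic_univ (w : W) : w ∈ cs.parabolic Set.univ := by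
  rw [parabolic, Set.image_univ, subgroup_closure_range_simple]
  trivial

theorem mem_parabolic_singleton {i : B} {w : W} :
    w ∈ cs.parabolic {i} ↔ w = 1 ∨ w = cs.simple i := by
  constructor
  · intro h
    rw [parabolic, Set.image_singleton] at h
    induction h using Subgroup.closure_induction_left with
    | one => exact .inl rfl
    | mul_left x hx y _ ih =>
      obtain rfl := hx
      rcases ih with rfl | rfl <;> simp
    | inv_mul_cancel x hx y _ ih =>
      obtain rfl := hx
      rcases ih with rfl | rfl <;> simp
  · rintro (rfl | rfl)
    · exact one_mem _
    · exact simple_mem_parabolic rfl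

@[elab_as_elim]
theorem parabolic_induction_left {K : Set B} {p : W → Prop} {w : W} (hw : w ∈ cs.parabolic K)
    (one : p 1) (simple_mul : ∀ i ∈ K, ∀ u ∈ cs.parabolic K, p u → p (cs.simple i * u)) : p w := by
  rw [parabolic] at hw
  induction hw using Subgroup.closure_induction_left with
  | one => exact one
  | mul_left x hx y hy ih =>
    obtain ⟨i, hi, rfl⟩ := hx
    exact simple_mul i hi y hy ih
  | inv_mul_cancel x hx y hy ih =>
    obtain ⟨i, hi, rfl⟩ := hx
    rw [inv_simple]
    exact simple_mul i hi y hy ih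

/-- An element of `W_K` has a reduced word with letters in `K`. -/
theorem exists_isReduced_of_mem_parabolic {K : Set B} {w : W} (hw : w ∈ cs.parabolic K) :
    ∃ ω : List B, (∀ i ∈ ω, i ∈ K) ∧ cs.IsReduced ω ∧ w = cs.wordProd ω := by
  -- Inversion turns the left multiplications of the induction into right ones, where the exchange
  -- condition applies.
  suffices h : ∃ ω : List B, (∀ i ∈ ω, i ∈ K) ∧ cs.IsReduced ω ∧ w⁻¹ = cs.wordProd ω by
    obtain ⟨ω, h1, h2, h3⟩ := h
    exact ⟨ω.reverse, by simpa using h1, h2.reverse, by rw [wordProd_reverse, ← h3, inv_inv]⟩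
  refine cs.parabolic_induction_left hw ⟨[], by simp, by simp [IsReduced], by simp⟩ ?_
  rintro i hi u - ⟨ω, h1, h2, h3⟩
  rw [mul_inv_rev, inv_simple, h3]
  rcases cs.length_mul_simple (cs.wordProd ω) i with h | h
  · refine ⟨ω ++ [i], ?_, ?_, by simp [wordProd_append]⟩
    · intro j hj
      rcases List.mem_append.1 hj with hj | hj
      · exact h1 j hj
      · rw [List.mem_singleton.1 hj]
        exact hi
    · rw [IsReduced, wordProd_append, wordProd_singleton, h, h2.eq]
      simp
  · obtain ⟨j, hj, hji⟩ := cs.exists_eraseIdx_of_isRightDescent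
      (show cs.IsRightDescent (cs.wordProd ω) i by rw [IsRightDescent]; omega)
    refine ⟨ω.eraseIdx j, fun k hk => h1 k (List.mem_of_mem_eraseIdx hk), ?_, hji⟩
    rw [IsReduced, ← hji, List.length_eraseIdx_of_lt hj]
    have := h2.eq
    omega

/-- Induction along reduced words in `W_K`. -/
@[elab_as_elim]
theorem parabolic_reduced_induction {K : Set B} {p : W → Prop} {w : W} (hw : w ∈ cs.parabolic K)
    (one : p 1) (simple_mul : ∀ i ∈ K, ∀ u ∈ cs.parabolic K,
      cs.length (cs.simple i * u) = cs.length u + 1 → p u → p (cs.simple i * u)) : p w := by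
  obtain ⟨ω, h1, h2, rfl⟩ := cs.exists_isReduced_of_mem_parabolic hw
  clear hw
  suffices h : cs.wordProd ω ∈ cs.parabolic K ∧ p (cs.wordProd ω) from h.2
  induction ω with
  | nil => exact ⟨by simp [one_mem], by simpa using one⟩
  | cons i ω ih =>
    have h3 : cs.IsReduced ω := by simpa using h2.drop 1
    obtain ⟨h4, h5⟩ := ih (fun j hj => h1 j (by simp [hj])) h3
    rw [wordProd_cons]
    refine ⟨mul_mem (simple_mem_parabolic (h1 i (by simp))) h4,
      simple_mul i (h1 i (by simp)) _ h4 ?_ h5⟩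
    rw [← wordProd_cons, h2.eq, h3.eq, List.length_cons]

theorem exists_isLeftDescent_of_mem_parabolic {K : Set B} {w : W} (hw : w ∈ cs.parabolic K)
    (h : w ≠ 1) : ∃ i ∈ K, cs.IsLeftDescent w i := by
  revert h
  refine cs.parabolic_reduced_induction hw (by simp) ?_
  rintro i hi u - hl - -
  refine ⟨i, hi, ?_⟩
  rw [IsLeftDescent, simple_mul_simple_cancel_left]
  omega

/-- If `w` has no left descent in `K`, then lengths add in the products `u * w` with
`u ∈ W_K`. -/
theorem length_mul_of_forall_not_isLeftDescent {K : Set B} {w : W}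
    (hw : ∀ i ∈ K, ¬ cs.IsLeftDescent w i) {u : W} (hu : u ∈ cs.parabolic K) :
    cs.length (u * w) = cs.length u + cs.length w := by
  -- A shortest element `d` of the coset `W_K w`: if lengths failed to add for `d`, exchange would
  -- produce a shorter coset element.
  obtain ⟨d, ⟨v, hv, hd⟩, hmin⟩ := exists_minimalFor_of_wellFoundedLT
    (fun d => ∃ v ∈ cs.parabolic K, w = v * d) cs.length ⟨w, 1, one_mem _, by simp⟩
  have key : ∀ u ∈ cs.parabolic K, cs.length (u * d) = cs.length u + cs.length d := by
    intro u hu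
    refine cs.parabolic_reduced_induction hu (by simp) ?_
    intro i hi u hu hl ih
    rcases cs.length_simple_mul (u * d) i with h | h
    · rw [mul_assoc, h, ih, hl]
      ring
    · obtain ⟨d', hd', hlt⟩ := cs.exists_simple_mul_eq (u := u) (v := d) (i := i)
        (by omega) (by omega)
      have h1 : w = v * u⁻¹ * cs.simple i * u * d' := by
        rw [mul_assoc _ u, ← hd', hd]
        simp [mul_assoc]
      have := hmin ⟨_, mul_mem (mul_mem (mul_mem hv (inv_mem hu)) (simple_mem_parabolic hi)) hu, h1⟩
        hlt.le
      omega
  -- A first letter of `v` would be a left descent of `w` in `K`; hence `w` is itself the shortest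
  -- element.
  have hv1 : v = 1 := by
    by_contra hne
    obtain ⟨i, hi, hvi⟩ := cs.exists_isLeftDescent_of_mem_parabolic hv hne
    refine hw i hi ?_
    rw [IsLeftDescent] at hvi ⊢
    rw [hd, ← mul_assoc, key _ hv, key _ (mul_mem (simple_mem_parabolic hi) hv)]
    omega
  rw [hd, hv1, one_mul]
  exact key u hu

/-- If all elements of `K` are left descents of `w`, then every element of `W_K` is a prefix
of `w`. -/
theorem length_eq_add_of_forall_isLeftDescent {K : Set B} {w : W}
    (hw : ∀ i ∈ K, cs.IsLeftDescent w i) {u : W} (hu : u ∈ cs.parabolic K) :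
    cs.length w = cs.length u + cs.length (u⁻¹ * w) := by
  refine cs.parabolic_reduced_induction hu (by simp) ?_
  intro i hi u hu hl ih
  -- As `sᵢ u` is longer than `u`, exchange must remove a letter from `u⁻¹ w`, so the prefix grows
  -- by one letter.
  obtain ⟨v, hv, hlt⟩ := cs.exists_simple_mul_eq (u := u) (v := u⁻¹ * w) (i := i)
    (by rw [mul_inv_cancel_left]; exact hw i hi) (by omega)
  rw [mul_inv_cancel_left] at hv
  have h1 : (cs.simple i * u)⁻¹ * w = v := by
    rw [mul_inv_rev, inv_simple, mul_assoc, hv, inv_mul_cancel_left]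
  have h2 := cs.length_mul_le (cs.simple i * u) ((cs.simple i * u)⁻¹ * w)
  rw [mul_inv_cancel_left] at h2
  rw [h1] at h2 ⊢
  omega

/-! ### Longest elements -/

theorem IsLongestIn.isLeftDescent {cs : CoxeterSystem M W} {K : Set B} {w : W}
    (hw : cs.IsLongestIn K w) {i : B} (hi : i ∈ K) : cs.IsLeftDescent w i := by
  rw [IsLeftDescent, lt_iff_le_and_ne]
  exact ⟨hw.2 _ (mul_mem (simple_mem_parabolic hi) hw.1), cs.length_simple_mul_ne w i⟩

theorem IsLongestIn.eq {cs : CoxeterSystem M W} {K : Set B} {w w' : W}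
    (hw : cs.IsLongestIn K w) (hw' : cs.IsLongestIn K w') : w = w' := by
  have h := cs.length_eq_add_of_forall_isLeftDescent (fun i => hw.isLeftDescent (i := i)) hw'.1
  have h' := hw'.2 w hw.1
  have h1 : w'⁻¹ * w = 1 := by
    rw [← cs.length_eq_zero_iff]
    omega
  exact (inv_mul_eq_one.1 h1).symm

variable [Finite W]

theorem isLongestIn_longest (K : Set B) : cs.IsLongestIn K (cs.longest K) :=
  (cs.exists_isLongestIn K).choose_spec

theorem longest_inv (K : Set B) : (cs.longest K)⁻¹ = cs.longest K := by
  have h := cs.isLongestIn_longest K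
  exact IsLongestIn.eq ⟨inv_mem h.1, by simpa using h.2⟩ h

theorem length_le_longest_univ (w : W) : cs.length w ≤ cs.length (cs.longest Set.univ) :=
  (cs.isLongestIn_longest _).2 w (cs.mem_parabolic_univ w)

theorem eq_longest_univ_of_length_le {w : W}
    (h : cs.length (cs.longest Set.univ) ≤ cs.length w) : w = cs.longest Set.univ :=
  IsLongestIn.eq ⟨cs.mem_parabolic_univ w, fun u _ => (cs.length_le_longest_univ u).trans h⟩
    (cs.isLongestIn_longest _)

theorem eq_longest_univ_of_forall_isLeftDescent {w : W} (h : ∀ i, cs.IsLeftDescent w i) :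
    w = cs.longest Set.univ := by
  have := cs.length_eq_add_of_forall_isLeftDescent (K := Set.univ) (fun i _ => h i)
    (cs.mem_parabolic_univ (cs.longest Set.univ))
  exact cs.eq_longest_univ_of_length_le (by omega)

theorem length_longest_mul_longest_univ (K : Set B) :
    cs.length (cs.longest K * cs.longest Set.univ) + cs.length (cs.longest K) =
      cs.length (cs.longest Set.univ) := by
  have h := cs.length_eq_add_of_forall_isLeftDescent (K := Set.univ)
    (fun i hi => (cs.isLongestIn_longest _).isLeftDescent hi)
    (cs.mem_parabolic_univ (cs.longest K))
  rw [longest_inv] at h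
  omega

end CoxeterSystem

/-! ### Diameters of Cayley graphs -/

/-- A criterion for a function to be the distance function of a graph. -/
theorem SimpleGraph.edist_eq_of_forall {V : Type*} (G : SimpleGraph V) (f : V → V → ℕ)
    (hf : ∀ x y, f x y = 0 ↔ x = y) (hadj : ∀ x y z, G.Adj x y → f x z ≤ f y z + 1)
    (hex : ∀ x z, x ≠ z → ∃ y, G.Adj x y ∧ f y z + 1 = f x z) (x y : V) :
    G.edist x y = f x y := by
  apply le_antisymm
  · suffices h : ∀ n x, f x y = n → ∃ p : G.Walk x y, p.length = n by
      obtain ⟨p, hp⟩ := h _ x rfl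
      rw [← hp]
      exact p.edist_le
    intro n
    induction n with
    | zero =>
      intro x h
      obtain rfl := (hf x y).1 h
      exact ⟨.nil, rfl⟩
    | succ n ih =>
      intro x h
      obtain ⟨z, hz, hfz⟩ := hex x y (fun hxy => by rw [(hf x y).2 hxy] at h; omega)
      obtain ⟨p, hp⟩ := ih z (by omega)
      exact ⟨.cons hz p, by simp [hp]⟩
  · refine le_iInf fun p => ?_
    rw [Nat.cast_le]
    induction p with
    | nil => rw [(hf _ _).2 rfl]; exact Nat.zero_le _
    | cons h p ih =>
      rw [Walk.length_cons]
      exact (hadj _ _ _ h).trans (by omega)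

theorem SimpleGraph.dist_eq_of_forall {V : Type*} (G : SimpleGraph V) (f : V → V → ℕ)
    (hf : ∀ x y, f x y = 0 ↔ x = y) (hadj : ∀ x y z, G.Adj x y → f x z ≤ f y z + 1)
    (hex : ∀ x z, x ≠ z → ∃ y, G.Adj x y ∧ f y z + 1 = f x z) (x y : V) :
    G.dist x y = f x y := by
  rw [SimpleGraph.dist, G.edist_eq_of_forall f hf hadj hex, ENat.toNat_natCast]

theorem SimpleGraph.diam_eq_of_edist_eq {V : Type*} {G : SimpleGraph V} {f : V → V → ℕ}
    (hf : ∀ x y, G.edist x y = f x y) {n : ℕ} (hle : ∀ x y, f x y ≤ n)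
    (hex : ∃ x y, f x y = n) : G.diam = n := by
  have : G.ediam = n := by
    apply le_antisymm
    · exact ediam_le_of_edist_le fun u v => by rw [hf]; exact_mod_cast hle u v
    · obtain ⟨x, y, h⟩ := hex
      rw [← h, ← hf]
      exact edist_le_ediam
  rw [SimpleGraph.diam, this, ENat.toNat_natCast]

namespace CoxeterSystem

variable {B W : Type*} [Group W] {M : CoxeterMatrix B} (cs : CoxeterSystem M W)

theorem length_inv_mul_le_of_adj {x y z : W} {i : B}
    (h : x * cs.simple i = y ∨ x = y * cs.simple i) :
    cs.length (x⁻¹ * z) ≤ cs.length (y⁻¹ * z) + 1 := by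
  have h1 : x⁻¹ * z = cs.simple i * (y⁻¹ * z) := by
    rcases h with rfl | rfl <;> simp [mul_assoc]
  rw [h1]
  rcases cs.length_simple_mul (y⁻¹ * z) i with h | h <;> omega

theorem length_inv_mul_eq_zero_iff {x y : W} : cs.length (x⁻¹ * y) = 0 ↔ x = y := by
  rw [length_eq_zero_iff, inv_mul_eq_one]

theorem mul_simple_ne_self (x : W) (i : B) : x ≠ x * cs.simple i := fun h =>
  cs.length_mul_simple_ne x i (congrArg _ h.symm)

theorem edist_mulCayley (x y : W) :
    (SimpleGraph.mulCayley (Set.range cs.simple)).edist x y = cs.length (x⁻¹ * y) := by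
  refine SimpleGraph.edist_eq_of_forall _ (fun x y : W => cs.length (x⁻¹ * y))
    (fun _ _ => cs.length_inv_mul_eq_zero_iff) ?_ ?_ x y
  · intro x y z h
    rw [SimpleGraph.mulCayley_adj'] at h
    obtain ⟨-, -, ⟨i, rfl⟩, h⟩ := h
    exact cs.length_inv_mul_le_of_adj h
  · intro x z hxz
    obtain ⟨i, hi⟩ := cs.exists_leftDescent_of_ne_one (w := x⁻¹ * z)
      (by rwa [Ne, inv_mul_eq_one])
    refine ⟨x * cs.simple i, ?_, ?_⟩
    · rw [SimpleGraph.mulCayley_adj']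
      exact ⟨cs.mul_simple_ne_self x i, _, ⟨i, rfl⟩, .inl rfl⟩
    · rw [mul_inv_rev, inv_simple, mul_assoc]
      exact cs.isLeftDescent_iff.1 hi

theorem edist_mulCayley_parabolic (K : Set B) (x y : cs.parabolic K) :
    (SimpleGraph.mulCayley {g : cs.parabolic K | ∃ i ∈ K, (g : W) = cs.simple i}).edist x y =
      cs.length ((x : W)⁻¹ * y) := by
  refine SimpleGraph.edist_eq_of_forall _
    (fun x y : cs.parabolic K => cs.length ((x : W)⁻¹ * y))
    (fun _ _ => by rw [length_inv_mul_eq_zero_iff, Subtype.coe_inj]) ?_ ?_ x y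
  · intro x y z h
    rw [SimpleGraph.mulCayley_adj'] at h
    obtain ⟨-, g, ⟨i, -, hg⟩, h⟩ := h
    refine cs.length_inv_mul_le_of_adj (i := i) ?_
    rw [← hg]
    exact_mod_cast h
  · intro x z hxz
    obtain ⟨i, hiK, hi⟩ := cs.exists_isLeftDescent_of_mem_parabolic
      (mul_mem (inv_mem x.2) z.2) (by rwa [Ne, inv_mul_eq_one, Subtype.coe_inj])
    refine ⟨x * ⟨cs.simple i, simple_mem_parabolic hiK⟩, ?_, ?_⟩
    · rw [SimpleGraph.mulCayley_adj']
      exact ⟨fun h => cs.mul_simple_ne_self x i (congrArg Subtype.val h), _,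
        ⟨i, hiK, rfl⟩, .inl rfl⟩
    · push_cast
      rw [mul_inv_rev, inv_simple, mul_assoc]
      exact cs.isLeftDescent_iff.1 hi

variable [Finite W]

theorem diam_eq : cs.diam = cs.length (cs.longest Set.univ) :=
  SimpleGraph.diam_eq_of_edist_eq cs.edist_mulCayley (fun _ _ => cs.length_le_longest_univ _)
    ⟨1, cs.longest Set.univ, by simp⟩

theorem parabolicDiam_eq (K : Set B) : cs.parabolicDiam K = cs.length (cs.longest K) :=
  SimpleGraph.diam_eq_of_edist_eq (cs.edist_mulCayley_parabolic K)
    (fun x y => (cs.isLongestIn_longest K).2 _ (mul_mem (inv_mem x.2) y.2))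
    ⟨1, ⟨cs.longest K, (cs.isLongestIn_longest K).1⟩, by simp⟩

end CoxeterSystem

namespace Building

open CoxeterSystem

variable {B W : Type*} [Group W] {M : CoxeterMatrix B} {cs : CoxeterSystem M W} {C : Type*}
  (Δ : Building cs C)

/-! ### The Weyl distance -/

theorem δ_self (x : C) : Δ.δ x x = 1 := (Δ.δ_eq_one_iff x x).2 rfl

theorem ne_of_δ_eq_simple {x y : C} {i : B} (h : Δ.δ x y = cs.simple i) : x ≠ y := by
  rintro rfl
  rw [δ_self] at h
  simpa [← h] using cs.length_simple i

theorem δ_eq_simple_symm {x y : C} {i : B} (h : Δ.δ x y = cs.simple i) :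
    Δ.δ y x = cs.simple i := by
  rcases Δ.δ_of_adj x y x i h with h1 | h1
  · rw [δ_self] at h1
    rw [← inv_simple]
    exact (inv_eq_of_mul_eq_one_right h1.symm).symm
  · rw [δ_self] at h1
    exact absurd ((Δ.δ_eq_one_iff y x).1 h1.symm).symm (Δ.ne_of_δ_eq_simple h)

theorem exists_δ_eq_simple_mul (x y : C) (i : B) :
    ∃ z, Δ.δ x z = cs.simple i ∧ Δ.δ z y = cs.simple i * Δ.δ x y := by
  obtain ⟨z, h1, h2⟩ := Δ.exists_adj x y i
  exact ⟨z, Δ.δ_eq_simple_symm h1, h2⟩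

/-- `y` is the end of a gallery of type `ω` that starts in `x`. -/
def HasGallery : List B → C → C → Prop
  | [], x, y => x = y
  | i :: ω, x, y => ∃ z, Δ.δ x z = cs.simple i ∧ HasGallery ω z y

theorem hasGallery_of_δ_eq {ω : List B} {x y : C} (h : Δ.δ x y = cs.wordProd ω) :
    Δ.HasGallery ω x y := by
  induction ω generalizing x with
  | nil => exact (Δ.δ_eq_one_iff x y).1 (by simpa using h)
  | cons i ω ih =>
    obtain ⟨z, h1, h2⟩ := Δ.exists_δ_eq_simple_mul x y i
    refine ⟨z, h1, ih ?_⟩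
    rw [h2, h, wordProd_cons, simple_mul_simple_cancel_left]

theorem δ_eq_of_hasGallery {ω : List B} (hω : cs.IsReduced ω) {x y : C}
    (h : Δ.HasGallery ω x y) : Δ.δ x y = cs.wordProd ω := by
  induction ω generalizing x with
  | nil => simpa using (Δ.δ_eq_one_iff x y).2 h
  | cons i ω ih =>
    obtain ⟨z, h1, h2⟩ := h
    have h3 : cs.IsReduced ω := by simpa using hω.drop 1
    have h4 := ih h3 h2
    rw [wordProd_cons, ← h4]
    refine Δ.δ_of_adj_of_length x z y i h1 ?_
    rw [h4, ← wordProd_cons, hω.eq, h3.eq, List.length_cons]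

variable {Δ} in
theorem HasGallery.append {ω η : List B} {x y z : C} (h : Δ.HasGallery ω x y)
    (h' : Δ.HasGallery η y z) : Δ.HasGallery (ω ++ η) x z := by
  induction ω generalizing x with
  | nil =>
    obtain rfl : x = y := h
    exact h'
  | cons i ω ih =>
    obtain ⟨u, h1, h2⟩ := h
    exact ⟨u, h1, ih h2⟩

variable {Δ} in
theorem HasGallery.reverse {ω : List B} {x y : C} (h : Δ.HasGallery ω x y) :
    Δ.HasGallery ω.reverse y x := by
  induction ω generalizing x with
  | nil => exact Eq.symm h
  | cons i ω ih =>
    obtain ⟨u, h1, h2⟩ := h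
    rw [List.reverse_cons]
    exact (ih h2).append ⟨x, Δ.δ_eq_simple_symm h1, rfl⟩

theorem δ_inv (x y : C) : (Δ.δ x y)⁻¹ = Δ.δ y x := by
  obtain ⟨ω, hω, h⟩ := cs.exists_isReduced (Δ.δ x y)
  rw [Δ.δ_eq_of_hasGallery hω.reverse (Δ.hasGallery_of_δ_eq h).reverse, h, wordProd_reverse]

theorem δ_of_adj_right {x y z : C} {i : B} (h : Δ.δ y z = cs.simple i) :
    Δ.δ x z = Δ.δ x y * cs.simple i ∨ Δ.δ x z = Δ.δ x y := by
  rw [← Δ.δ_inv z x, ← Δ.δ_inv y x]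
  rcases Δ.δ_of_adj z y x i (Δ.δ_eq_simple_symm h) with h | h <;> rw [h] <;> simp

theorem δ_of_adj_of_length_right {x y z : C} {i : B} (h : Δ.δ y z = cs.simple i)
    (hl : cs.length (Δ.δ x y * cs.simple i) = cs.length (Δ.δ x y) + 1) :
    Δ.δ x z = Δ.δ x y * cs.simple i := by
  have h1 : Δ.δ x y * cs.simple i = (cs.simple i * Δ.δ y x)⁻¹ := by
    rw [mul_inv_rev, δ_inv, inv_simple]
  rw [h1, length_inv, ← Δ.δ_inv y x, length_inv] at hl
  rw [← Δ.δ_inv z x, Δ.δ_of_adj_of_length z y x i (Δ.δ_eq_simple_symm h) hl, h1]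

/-- There is a chamber `z` at distance `u` from `x` such that the distances from `z` to `x` and
from `x` to `y` multiply. -/
theorem exists_δ_eq_mul (x y : C) (u : W) : ∃ z, Δ.δ z x = u ∧ Δ.δ z y = u * Δ.δ x y := by
  have hu := cs.mem_parabolic_univ u
  refine cs.parabolic_reduced_induction hu
    ⟨x, Δ.δ_self x, (one_mul _).symm⟩ ?_
  rintro i - u - hl ⟨z, h1, h2⟩
  obtain ⟨z', h3, h4⟩ := Δ.exists_adj z y i
  refine ⟨z', ?_, by rw [h4, h2, mul_assoc]⟩
  rw [Δ.δ_of_adj_of_length z' z x i h3 (by rw [h1, hl]), h1]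

theorem exists_δ_eq_mul_right (x y : C) (u : W) :
    ∃ z, Δ.δ y z = u ∧ Δ.δ x z = Δ.δ x y * u := by
  obtain ⟨z, h1, h2⟩ := Δ.exists_δ_eq_mul y x u⁻¹
  exact ⟨z, by rw [← Δ.δ_inv z y, h1, inv_inv],
    by rw [← Δ.δ_inv z x, h2, mul_inv_rev, inv_inv, δ_inv]⟩

theorem exists_δ_eq (w : W) : ∃ x y, Δ.δ x y = w := by
  obtain ⟨x⟩ := Δ.nonempty
  obtain ⟨z, h, -⟩ := Δ.exists_δ_eq_mul x x w
  exact ⟨z, x, h⟩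

/-! ### Residues -/

variable {Δ} in
theorem mem_residue_iff {K : Set B} {x y : C} :
    y ∈ Δ.residue K x ↔ Δ.δ x y ∈ cs.parabolic K := Iff.rfl

theorem mem_residue_self (K : Set B) (x : C) : x ∈ Δ.residue K x := by
  rw [mem_residue_iff, δ_self]
  exact one_mem _

/-- Along a gallery with letters in `K`, each step changes the distance to `z` by at most a left
factor from `K`. This makes `K`-residues equivalence classes. -/
theorem exists_mem_parabolic_δ_eq_mul {K : Set B} {x y : C} (h : Δ.δ x y ∈ cs.parabolic K)
    (z : C) : ∃ u ∈ cs.parabolic K, Δ.δ x z = u * Δ.δ y z := by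
  obtain ⟨ω, hK, -, hω⟩ := cs.exists_isReduced_of_mem_parabolic h
  have hg := Δ.hasGallery_of_δ_eq hω
  clear hω h
  induction ω generalizing x with
  | nil =>
    obtain rfl : x = y := hg
    exact ⟨1, one_mem _, (one_mul _).symm⟩
  | cons i ω ih =>
    obtain ⟨t, h1, h2⟩ := hg
    obtain ⟨u, hu, htz⟩ := ih (fun j hj => hK j (by simp [hj])) h2
    rcases Δ.δ_of_adj x t z i h1 with h | h
    · exact ⟨cs.simple i * u, mul_mem (simple_mem_parabolic (hK i (by simp))) hu,
        by rw [h, htz, mul_assoc]⟩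
    · exact ⟨u, hu, by rw [h, htz]⟩

variable {Δ}

theorem mem_residue_symm {K : Set B} {x y : C} (h : y ∈ Δ.residue K x) : x ∈ Δ.residue K y := by
  rw [mem_residue_iff, ← δ_inv]
  exact inv_mem h

theorem mem_residue_trans {K : Set B} {x y z : C} (h : y ∈ Δ.residue K x)
    (h' : z ∈ Δ.residue K y) : z ∈ Δ.residue K x := by
  obtain ⟨u, hu, hz⟩ := Δ.exists_mem_parabolic_δ_eq_mul h z
  rw [mem_residue_iff, hz]
  exact mul_mem hu h'

theorem residue_eq_of_mem {K : Set B} {x y : C} (h : y ∈ Δ.residue K x) :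
    Δ.residue K x = Δ.residue K y :=
  Set.ext fun _ => ⟨mem_residue_trans (mem_residue_symm h), mem_residue_trans h⟩

theorem Simplex.exists_eq_residue {σ : Δ.Simplex} {x : C} (h : x ∈ σ.chambers) :
    ∃ K, σ.chambers = Δ.residue K x := by
  obtain ⟨K, y, hK⟩ := σ.isResidue
  rw [hK] at h ⊢
  exact ⟨K, residue_eq_of_mem h⟩

theorem mem_residue_singleton {i : B} {x y : C} :
    y ∈ Δ.residue {i} x ↔ y = x ∨ Δ.δ x y = cs.simple i := by
  rw [mem_residue_iff, mem_parabolic_singleton, δ_eq_one_iff, eq_comm]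

theorem mem_residue_of_δ_eq_simple {K : Set B} {i : B} (hi : i ∈ K) {x y : C}
    (h : Δ.δ x y = cs.simple i) : y ∈ Δ.residue K x := by
  rw [mem_residue_iff, h]
  exact simple_mem_parabolic hi

theorem δ_eq_simple_of_adj_of_adj {i : B} {x y z : C} (hy : Δ.δ x y = cs.simple i)
    (hz : Δ.δ x z = cs.simple i) (hne : y ≠ z) : Δ.δ y z = cs.simple i := by
  have h : z ∈ Δ.residue {i} y := mem_residue_trans
    (mem_residue_symm (mem_residue_of_δ_eq_simple (Set.mem_singleton i) hy))
    (mem_residue_of_δ_eq_simple (Set.mem_singleton i) hz)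
  exact (mem_residue_singleton.1 h).resolve_left hne.symm

/-- A property that is inherited by `i`-adjacent chambers, for `i ∈ K`, holds in the whole
`K`-residue. -/
theorem residue_induction {K : Set B} {p : C → Prop} {x y : C} (hy : y ∈ Δ.residue K x) (hx : p x)
    (h : ∀ i ∈ K, ∀ y z, p y → Δ.δ y z = cs.simple i → p z) : p y := by
  obtain ⟨ω, hK, -, hω⟩ := cs.exists_isReduced_of_mem_parabolic hy
  have hg := Δ.hasGallery_of_δ_eq hω
  clear hω hy
  induction ω generalizing x with
  | nil =>
    obtain rfl : x = y := hg
    exact hx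
  | cons i ω ih =>
    obtain ⟨t, h1, h2⟩ := hg
    exact ih (h i (hK i (by simp)) x t hx h1) (fun j hj => hK j (by simp [hj])) h2

/-! ### The gallery distance -/

variable (Δ)

theorem chamberGraph_adj_iff {x y : C} :
    Δ.chamberGraph.Adj x y ↔ ∃ i, Δ.δ x y = cs.simple i := by
  constructor
  · rintro ⟨hne, i, σ, ⟨z, hz⟩, hx, hy⟩
    rw [hz, compl_compl] at hx hy
    exact ⟨i, (mem_residue_singleton.1 (mem_residue_trans (mem_residue_symm hx) hy)).resolve_left
      hne.symm⟩
  · rintro ⟨i, hi⟩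
    exact ⟨Δ.ne_of_δ_eq_simple hi, i, ⟨Δ.residue {i} x, _, _, rfl⟩, ⟨x, by rw [compl_compl]⟩,
      Δ.mem_residue_self _ x, mem_residue_of_δ_eq_simple (Set.mem_singleton i) hi⟩

/-- The gallery distance is the length of the Weyl distance. -/
theorem galleryDist_eq (x y : C) : Δ.galleryDist x y = cs.length (Δ.δ x y) := by
  refine SimpleGraph.dist_eq_of_forall _ (fun x y => cs.length (Δ.δ x y))
    (fun x y => by rw [length_eq_zero_iff, δ_eq_one_iff]) ?_ ?_ x y
  · intro x y z h
    obtain ⟨i, hi⟩ := Δ.chamberGraph_adj_iff.1 h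
    rcases Δ.δ_of_adj x y z i hi with h | h
    · rw [h]
      rcases cs.length_simple_mul (Δ.δ y z) i with h | h <;> omega
    · rw [h]
      exact Nat.le_succ _
  · intro x z hxz
    obtain ⟨i, hi⟩ := cs.exists_leftDescent_of_ne_one (w := Δ.δ x z)
      (by rwa [Ne, δ_eq_one_iff])
    obtain ⟨y, hy, hyz⟩ := Δ.exists_δ_eq_simple_mul x z i
    refine ⟨y, Δ.chamberGraph_adj_iff.2 ⟨i, hy⟩, ?_⟩
    rw [hyz]
    exact cs.isLeftDescent_iff.1 hi

theorem chamberGraph_connected : Δ.chamberGraph.Connected := by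
  have := Δ.nonempty
  refine ⟨fun x y => ?_⟩
  obtain ⟨ω, -, hω⟩ := cs.exists_isReduced (Δ.δ x y)
  have hg := Δ.hasGallery_of_δ_eq hω
  clear hω
  induction ω generalizing x with
  | nil =>
    obtain rfl : x = y := hg
    rfl
  | cons i ω ih =>
    obtain ⟨t, h1, h2⟩ := hg
    exact (Δ.chamberGraph_adj_iff.2 ⟨i, h1⟩).reachable.trans (ih t h2)

theorem length_δ_triangle (x y z : C) :
    cs.length (Δ.δ x z) ≤ cs.length (Δ.δ x y) + cs.length (Δ.δ y z) := by
  simp only [← galleryDist_eq]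
  -- Connectedness is needed because `SimpleGraph.dist` is 0 between unreachable vertices.
  exact Δ.chamberGraph_connected.dist_triangle

theorem oppositeChambers_iff [Finite W] {x y : C} :
    Δ.OppositeChambers x y ↔ Δ.δ x y = cs.longest Set.univ := by
  constructor
  · intro h
    obtain ⟨x', y', h'⟩ := Δ.exists_δ_eq (cs.longest Set.univ)
    have := h x' y'
    rw [galleryDist_eq, galleryDist_eq, h'] at this
    exact cs.eq_longest_univ_of_length_le this
  · intro h x' y'
    rw [galleryDist_eq, galleryDist_eq, h]
    exact cs.length_le_longest_univ _

/-! ### Automorphisms -/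

theorem chamber_injective : Function.Injective Δ.chamber := by
  intro x y h
  exact Set.singleton_injective (congrArg Simplex.chambers h)

/-- The panels of a chamber are the simplices covered by it. -/
theorem covBy_chamber_iff {σ : Δ.Simplex} {x : C} :
    σ ⋖ Δ.chamber x ↔ ∃ i, σ.chambers = Δ.residue {i} x := by
  constructor
  · intro h
    obtain ⟨K, hK⟩ := Simplex.exists_eq_residue (Simplex.le_chamber_iff.1 h.le)
    have hne : K.Nonempty := by
      rw [Set.nonempty_iff_ne_empty]
      rintro rfl
      refine h.lt.not_ge (Simplex.le_iff.2 ?_)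
      rw [hK, residue_empty]
      rfl
    obtain ⟨i, hi⟩ := hne
    refine ⟨i, ?_⟩
    let τ : Δ.Simplex := ⟨Δ.residue {i} x, _, _, rfl⟩
    have h1 : σ ≤ τ := by
      rw [Simplex.le_iff, hK]
      exact fun y hy => cs.parabolic_mono (Set.singleton_subset_iff.2 hi) hy
    have h2 : τ < Δ.chamber x := by
      refine lt_of_le_of_ne (Simplex.le_chamber_iff.2 (Δ.mem_residue_self _ x)) fun h => ?_
      obtain ⟨y, hy, -⟩ := Δ.exists_δ_eq_simple_mul x x i
      have h3 : y ∈ (Δ.chamber x).chambers := h ▸ mem_residue_of_δ_eq_simple (Set.mem_singleton i) hy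
      exact Δ.ne_of_δ_eq_simple hy (Eq.symm h3)
    rcases h1.eq_or_lt with h3 | h3
    · rw [h3]
    · exact absurd h2 (h.2 h3)
  · rintro ⟨i, hi⟩
    obtain ⟨y, hy, -⟩ := Δ.exists_δ_eq_simple_mul x x i
    constructor
    · refine lt_of_le_of_ne (Simplex.le_chamber_iff.2 (hi ▸ Δ.mem_residue_self _ x)) ?_
      rintro rfl
      have h3 : y ∈ (Δ.chamber x).chambers := hi ▸ mem_residue_of_δ_eq_simple (Set.mem_singleton i) hy
      exact Δ.ne_of_δ_eq_simple hy (Eq.symm h3)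
    · intro τ h1 h2
      obtain ⟨K, hK⟩ := Simplex.exists_eq_residue (Simplex.le_chamber_iff.1 h2.le)
      have hne : K.Nonempty := by
        rw [Set.nonempty_iff_ne_empty]
        rintro rfl
        refine h2.not_ge (Simplex.le_iff.2 ?_)
        rw [hK, residue_empty]
        rfl
      obtain ⟨j, hj⟩ := hne
      obtain ⟨z, hz, -⟩ := Δ.exists_δ_eq_simple_mul x x j
      have h3 := Simplex.le_iff.1 h1.le (hK ▸ mem_residue_of_δ_eq_simple hj hz)
      rw [hi, mem_residue_singleton, hz] at h3
      have h4 : cs.simple j = cs.simple i :=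
        h3.resolve_left (Δ.ne_of_δ_eq_simple hz).symm
      refine h1.not_ge (Simplex.le_iff.2 ?_)
      rw [hi, hK]
      intro t ht
      rcases mem_residue_singleton.1 ht with rfl | ht
      · exact Δ.mem_residue_self _ _
      · exact mem_residue_of_δ_eq_simple hj (ht.trans h4.symm)

namespace Automorphism

variable {Δ} (θ : Δ.Automorphism)

theorem onChamber_mem_iff {σ : Δ.Simplex} {x : C} :
    θ.onChamber x ∈ (θ σ).chambers ↔ x ∈ σ.chambers := by
  rw [← Simplex.le_chamber_iff, ← Simplex.le_chamber_iff, ← apply_chamber, θ.le_iff_le]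

theorem onChamber_symm_onChamber (x : C) : onChamber θ.symm (θ.onChamber x) = x := by
  apply Δ.chamber_injective
  rw [← apply_chamber, ← apply_chamber]
  exact θ.symm_apply_apply _

theorem onChamber_onChamber_symm (x : C) : θ.onChamber (onChamber θ.symm x) = x := by
  apply Δ.chamber_injective
  rw [← apply_chamber, ← apply_chamber]
  exact θ.apply_symm_apply _

theorem onChamber_injective : Function.Injective θ.onChamber :=
  Function.LeftInverse.injective θ.onChamber_symm_onChamber

theorem exists_onChamber_eq_of_mem {σ : Δ.Simplex} {y : C} (h : y ∈ (θ σ).chambers) :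
    ∃ x ∈ σ.chambers, θ.onChamber x = y := by
  refine ⟨onChamber θ.symm y, ?_, θ.onChamber_onChamber_symm y⟩
  rwa [← θ.onChamber_mem_iff, onChamber_onChamber_symm]

/-- An automorphism maps the `i`-panel of a chamber to a panel of its image. -/
theorem exists_forall_δ_onChamber_eq_simple (x : C) (i : B) :
    ∃ j, ∀ y, Δ.δ x y = cs.simple i → Δ.δ (θ.onChamber x) (θ.onChamber y) = cs.simple j := by
  let σ : Δ.Simplex := ⟨Δ.residue {i} x, _, _, rfl⟩
  have h : θ σ ⋖ Δ.chamber (θ.onChamber x) := by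
    rw [← apply_chamber]
    exact (apply_covBy_apply_iff θ).2 (Δ.covBy_chamber_iff.2 ⟨i, rfl⟩)
  obtain ⟨j, hj⟩ := Δ.covBy_chamber_iff.1 h
  refine ⟨j, fun y hy => ?_⟩
  have h1 : θ.onChamber y ∈ (θ σ).chambers :=
    θ.onChamber_mem_iff.2 (mem_residue_of_δ_eq_simple (Set.mem_singleton i) hy)
  rw [hj, mem_residue_singleton] at h1
  exact h1.resolve_left fun h2 => Δ.ne_of_δ_eq_simple hy (θ.onChamber_injective h2).symm

/-- A gallery is mapped to a gallery of the same length. Its letters may change in a way depending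
on the chamber, so no induced permutation of `S` is needed. -/
theorem length_δ_onChamber_le (x y : C) :
    cs.length (Δ.δ (θ.onChamber x) (θ.onChamber y)) ≤ cs.length (Δ.δ x y) := by
  obtain ⟨ω, hω, h⟩ := cs.exists_isReduced (Δ.δ x y)
  have hg := Δ.hasGallery_of_δ_eq h
  rw [h, hω.eq]
  clear h hω
  induction ω generalizing x with
  | nil =>
    obtain rfl : x = y := hg
    simp [δ_self]
  | cons i ω ih =>
    obtain ⟨t, h1, h2⟩ := hg
    obtain ⟨j, hj⟩ := θ.exists_forall_δ_onChamber_eq_simple x i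
    have h3 := Δ.length_δ_triangle (θ.onChamber x) (θ.onChamber t) (θ.onChamber y)
    rw [hj t h1, length_simple] at h3
    have := ih t h2
    rw [List.length_cons]
    omega

end Automorphism

end Building

/-! ### Maximally displaced chambers -/

namespace Building

open CoxeterSystem

variable {B W : Type*} [Group W] {M : CoxeterMatrix B} {cs : CoxeterSystem M W} {C : Type*}
  {Δ : Building cs C}

namespace Automorphism

variable (θ : Δ.Automorphism)

theorem length_δ_onChamber (x y : C) :
    cs.length (Δ.δ (θ.onChamber x) (θ.onChamber y)) = cs.length (Δ.δ x y) := by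
  refine le_antisymm (θ.length_δ_onChamber_le x y) ?_
  have h := length_δ_onChamber_le θ.symm (θ.onChamber x) (θ.onChamber y)
  rwa [onChamber_symm_onChamber, onChamber_symm_onChamber] at h

/-- The chamber `x` attains the maximal displacement of `θ`. -/
def IsMaxDisplaced (x : C) : Prop :=
  ∀ y, cs.length (Δ.δ y (θ.onChamber y)) ≤ cs.length (Δ.δ x (θ.onChamber x))

variable {θ}

/-- If `x` is displaced maximally, by `w`, and `i` is no left descent of `w`, then all chambers
that are `i`-adjacent to `x` are displaced by `w` as well. -/
theorem IsMaxDisplaced.exists_of_not_isLeftDescent (hthick : Δ.IsThick) {x : C}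
    (hx : θ.IsMaxDisplaced x) {i : B} (hi : ¬ cs.IsLeftDescent (Δ.δ x (θ.onChamber x)) i) :
    ∃ j, cs.simple i * Δ.δ x (θ.onChamber x) = Δ.δ x (θ.onChamber x) * cs.simple j ∧
      ∀ y, Δ.δ x y = cs.simple i → Δ.δ (θ.onChamber x) (θ.onChamber y) = cs.simple j ∧
        Δ.δ y (θ.onChamber y) = Δ.δ x (θ.onChamber x) := by
  obtain ⟨j, hj⟩ := θ.exists_forall_δ_onChamber_eq_simple x i
  set w := Δ.δ x (θ.onChamber x) with hw
  rw [not_isLeftDescent_iff] at hi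
  have h1 : ∀ y, Δ.δ x y = cs.simple i → Δ.δ y (θ.onChamber x) = cs.simple i * w := fun y hy =>
    Δ.δ_of_adj_of_length y x _ i (Δ.δ_eq_simple_symm hy) hi
  have h2 : ∀ y, Δ.δ x y = cs.simple i →
      Δ.δ y (θ.onChamber y) = cs.simple i * w * cs.simple j := by
    intro y hy
    have h3 := Δ.δ_of_adj_right (x := y) (hj y hy)
    rw [h1 y hy] at h3
    refine h3.resolve_right fun h4 => ?_
    have h5 := hx y
    rw [h4, ← hw] at h5
    omega
  obtain ⟨y, z, hyz, hy, hz⟩ := hthick x i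
  have hθ : Δ.δ (θ.onChamber z) (θ.onChamber y) = cs.simple j :=
    δ_eq_simple_of_adj_of_adj (hj z hz) (hj y hy) (θ.onChamber_injective.ne hyz.symm)
  -- By maximality `sᵢ w sⱼ` is no longer than `w`, hence shorter than `sᵢ w`.
  have hlen : cs.length (cs.simple i * w * cs.simple j * cs.simple j) =
      cs.length (cs.simple i * w * cs.simple j) + 1 := by
    have h3 := hx y
    rw [h2 y hy, ← hw] at h3
    rcases cs.length_mul_simple (cs.simple i * w * cs.simple j) j with h | h
    · exact h
    · rw [simple_mul_simple_cancel_right] at h ⊢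
      omega
  have h3 : Δ.δ z (θ.onChamber y) = cs.simple i * w := by
    rw [Δ.δ_of_adj_of_length_right hθ (by rw [h2 z hz, hlen]), h2 z hz,
      simple_mul_simple_cancel_right]
  -- The distance from `z` to `yθ` is `sᵢ w`; seen through the `i`-adjacent chamber `y` it is `w sⱼ`
  -- or `sᵢ w sⱼ`, and the latter is impossible.
  have h4 : w = cs.simple i * w * cs.simple j := by
    have h5 := Δ.δ_of_adj z y (θ.onChamber y) i
      (δ_eq_simple_of_adj_of_adj hz hy hyz.symm)
    rw [h3, h2 y hy] at h5
    rcases h5 with h5 | h5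
    · exact mul_left_cancel h5
    · exact absurd h5 (cs.mul_simple_ne_self _ _)
  refine ⟨j, ?_, fun y hy => ⟨hj y hy, (h2 y hy).trans h4.symm⟩⟩
  conv_rhs => rw [h4]
  rw [simple_mul_simple_cancel_right]

/-- If `x` is displaced maximally, by `w`, then `w` displaces each chamber of the residue of `x`
whose type consists of the left ascents of `w`. -/
theorem IsMaxDisplaced.δ_eq_of_mem_residue (hthick : Δ.IsThick) {x : C}
    (hx : θ.IsMaxDisplaced x) {y : C}
    (hy : y ∈ Δ.residue {i | ¬ cs.IsLeftDescent (Δ.δ x (θ.onChamber x)) i} x) :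
    Δ.δ y (θ.onChamber y) = Δ.δ x (θ.onChamber x) := by
  refine residue_induction (p := fun y => Δ.δ y (θ.onChamber y) = Δ.δ x (θ.onChamber x)) hy rfl ?_
  intro i hi y z hpy hyz
  have hy' : θ.IsMaxDisplaced y := by
    intro t
    rw [hpy]
    exact hx t
  obtain ⟨j, -, h⟩ := hy'.exists_of_not_isLeftDescent hthick (i := i) (by rw [hpy]; exact hi)
  exact (h z hyz).2.trans hpy

end Automorphism

end Building

/-- The letters of a reduced word of `u` are moved through `w` one at a time, each becoming a single
letter of `L`. -/
theorem CoxeterSystem.exists_mul_eq_mul_of_mem_parabolic {B W : Type*} [Group W]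
    {M : CoxeterMatrix B} (cs : CoxeterSystem M W) {K L : Set B} {w : W}
    (h : ∀ i ∈ K, ∃ j ∈ L, cs.simple i * w = w * cs.simple j) {u : W}
    (hu : u ∈ cs.parabolic K) :
    ∃ v ∈ cs.parabolic L, u * w = w * v ∧ cs.length v ≤ cs.length u := by
  refine cs.parabolic_reduced_induction hu ⟨1, one_mem _, by simp⟩ ?_
  rintro i hi u - hl ⟨v, hv, huv, hlen⟩
  obtain ⟨j, hj, hij⟩ := h i hi
  refine ⟨cs.simple j * v, mul_mem (simple_mem_parabolic hj) hv, ?_, ?_⟩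
  · rw [mul_assoc, huv, ← mul_assoc, hij, mul_assoc]
  · have := cs.length_mul_le (cs.simple j) v
    rw [length_simple] at this
    omega

/-! ### Maximal displacement and opposite residues -/

namespace Building

open CoxeterSystem

variable {B W : Type*} [Group W] [Finite W] {M : CoxeterMatrix B} {cs : CoxeterSystem M W}
  {C : Type*} {Δ : Building cs C}

namespace Automorphism

theorem exists_isMaxDisplaced (θ : Δ.Automorphism) : ∃ x, θ.IsMaxDisplaced x := by
  have := Δ.nonempty
  -- There may be infinitely many chambers, but their displacements lie in the finite group `W`.
  obtain ⟨_, ⟨x, rfl⟩, hmax⟩ := Set.exists_max_image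
    (Set.range fun x => Δ.δ x (θ.onChamber x)) cs.length (Set.toFinite _) (Set.range_nonempty _)
  exact ⟨x, fun y => hmax _ ⟨y, rfl⟩⟩

variable {θ : Δ.Automorphism}

theorem IsMaxDisplaced.longest_mul (hthick : Δ.IsThick) {x : C} (hx : θ.IsMaxDisplaced x) :
    cs.longest {i | ¬ cs.IsLeftDescent (Δ.δ x (θ.onChamber x)) i} * Δ.δ x (θ.onChamber x) =
      cs.longest Set.univ := by
  set w := Δ.δ x (θ.onChamber x) with hw
  set K : Set B := {i | ¬ cs.IsLeftDescent w i}
  have hK := cs.isLongestIn_longest K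
  have hadd : ∀ {u : W}, u ∈ cs.parabolic K → cs.length (u * w) = cs.length u + cs.length w :=
    fun hu => cs.length_mul_of_forall_not_isLeftDescent (fun i hi => hi) hu
  apply cs.eq_longest_univ_of_forall_isLeftDescent
  intro i
  rw [IsLeftDescent, hadd hK.1]
  by_cases hi : cs.IsLeftDescent w i
  -- With `w_K w = w v`, a left descent `i` of `w` gives `ℓ(sᵢ w v) ≤ ℓ(sᵢ w) + ℓ(v) < ℓ(w) +
  -- ℓ(w_K)`.
  · obtain ⟨v, -, huv, hlen⟩ := cs.exists_mul_eq_mul_of_mem_parabolic (K := K) (L := Set.univ)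
      (w := w) (fun i hi => by
        obtain ⟨j, hj, -⟩ := hx.exists_of_not_isLeftDescent hthick hi
        exact ⟨j, trivial, hj⟩) hK.1
    have h1 := cs.length_mul_le (cs.simple i * w) v
    rw [IsLeftDescent] at hi
    rw [huv, ← mul_assoc]
    omega
  · have h1 := hK.isLeftDescent (i := i) hi
    rw [IsLeftDescent] at h1
    rw [← mul_assoc, hadd (mul_mem (simple_mem_parabolic hi) hK.1)]
    omega

/-- If `x` is displaced maximally, by `w`, then the residue of `x` whose type consists of the
left ascents of `w` is opposite its image. -/
theorem IsMaxDisplaced.mem_Opp (hthick : Δ.IsThick) {x : C} (hx : θ.IsMaxDisplaced x) :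
    (⟨Δ.residue {i | ¬ cs.IsLeftDescent (Δ.δ x (θ.onChamber x)) i} x, _, _, rfl⟩ : Δ.Simplex) ∈
      Opp θ := by
  have hlong := hx.longest_mul hthick
  have hres := fun y => hx.δ_eq_of_mem_residue hthick (y := y)
  set w := Δ.δ x (θ.onChamber x) with hw
  set K : Set B := {i | ¬ cs.IsLeftDescent w i}
  have hK := cs.isLongestIn_longest K
  set σ : Δ.Simplex := ⟨Δ.residue K x, _, _, rfl⟩ with hσ
  constructor
  · intro z hz
    have hwz : Δ.δ z (θ.onChamber z) = w := hres z hz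
    have hz' : θ.IsMaxDisplaced z := by
      intro t
      rw [hwz]
      exact hx t
    obtain ⟨L, hL⟩ := Simplex.exists_eq_residue (θ.onChamber_mem_iff.2 hz)
    obtain ⟨v, hv, huv, -⟩ := cs.exists_mul_eq_mul_of_mem_parabolic (K := K)
      -- Membership in the image residue only shows `sⱼ ∈ W_L`, so this set replaces `L`; it
      -- generates no more than `W_L`.
      (L := {j | cs.simple j ∈ cs.parabolic L}) (w := w) (fun i hi => by
        obtain ⟨j, hj, hy⟩ := hz'.exists_of_not_isLeftDescent hthick (i := i)
          (by rw [hwz]; exact hi)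
        rw [hwz] at hj
        refine ⟨j, ?_, hj⟩
        obtain ⟨y, hzy, -⟩ := Δ.exists_δ_eq_simple_mul z z i
        have hyσ : y ∈ σ.chambers := mem_residue_trans hz (mem_residue_of_δ_eq_simple hi hzy)
        rw [← θ.onChamber_mem_iff, hL, mem_residue_iff, (hy y hzy).1] at hyσ
        exact hyσ) hK.1
    have hvL : v ∈ cs.parabolic L := by
      refine (Subgroup.closure_le _).2 ?_ hv
      rintro _ ⟨j, hj, rfl⟩
      exact hj
    obtain ⟨y, hy, hzy⟩ := Δ.exists_δ_eq_mul_right z (θ.onChamber z) v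
    refine ⟨y, ?_, ?_⟩
    · rw [hL, mem_residue_iff, hy]
      exact hvL
    · rw [oppositeChambers_iff, hzy, hwz, ← huv, hlong]
  · intro y hy
    obtain ⟨z, hz, rfl⟩ := θ.exists_onChamber_eq_of_mem hy
    obtain ⟨t, ht, htz⟩ := Δ.exists_δ_eq_mul z (θ.onChamber z) (cs.longest K)
    refine ⟨t, mem_residue_trans hz ?_, ?_⟩
    · apply mem_residue_symm
      rw [mem_residue_iff, ht]
      exact hK.1
    · rw [oppositeChambers_iff, htz, hres z hz, hlong]

/-- A chamber `c` of `σ` is opposite `eθ` for some `e` in `σ`. Go from `c` to `eθ` through `cθ`: the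
second part has the length of `δ(c, e)`, which lies in `W_{S∖J}`. -/
theorem longest_univ_le_of_mem_Opp {x : C} (hx : θ.IsMaxDisplaced x) {J : Set B} {σ : Δ.Simplex}
    (hσ : σ ∈ Opp θ) (hJ : σ.HasType J) :
    cs.length (cs.longest Set.univ) ≤
      cs.length (Δ.δ x (θ.onChamber x)) + cs.length (cs.longest Jᶜ) := by
  obtain ⟨c, hc⟩ := hJ
  have hcσ : c ∈ σ.chambers := hc ▸ Δ.mem_residue_self _ c
  obtain ⟨d, hd, hopp⟩ := hσ.1 c hcσ
  obtain ⟨e, he, rfl⟩ := θ.exists_onChamber_eq_of_mem hd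
  rw [oppositeChambers_iff] at hopp
  rw [hc] at he
  have h1 := Δ.length_δ_triangle c (θ.onChamber c) (θ.onChamber e)
  rw [hopp, length_δ_onChamber] at h1
  have h2 := (cs.isLongestIn_longest Jᶜ).2 _ he
  have h3 := hx c
  omega

/-- A chamber that is displaced maximally by a capped automorphism of type `J` is displaced by
`w_{S ∖ J} w₀`. -/
theorem IsMaxDisplaced.δ_eq (hthick : Δ.IsThick) (hcapped : θ.IsCapped) {x : C}
    (hx : θ.IsMaxDisplaced x) :
    Δ.δ x (θ.onChamber x) = cs.longest θ.typeᶜ * cs.longest Set.univ := by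
  have hlong := hx.longest_mul hthick
  have hOpp := hx.mem_Opp hthick
  obtain ⟨σ, hσ, hJ⟩ := hcapped
  have hle := longest_univ_le_of_mem_Opp hx hσ hJ
  set w := Δ.δ x (θ.onChamber x) with hw
  set K : Set B := {i | ¬ cs.IsLeftDescent w i}
  have hK := cs.isLongestIn_longest K
  have hsub : θ.typeᶜ ⊆ K := by
    rw [Set.compl_subset_comm]
    exact Set.subset_sUnion_of_mem ⟨_, hOpp, x, by rw [compl_compl]⟩
  have hadd := cs.length_mul_of_forall_not_isLeftDescent (fun i (hi : i ∈ K) => hi) hK.1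
  rw [hlong] at hadd
  have hlongest : cs.longest θ.typeᶜ = cs.longest K := by
    -- `hadd` and `hle` give `ℓ(w_K) ≤ ℓ(w_{S∖J})`, so `w_{S∖J}`, which lies in `W_K`, is longest
    -- there.
    refine IsLongestIn.eq ⟨cs.parabolic_mono hsub (cs.isLongestIn_longest _).1,
      fun u hu => (hK.2 u hu).trans ?_⟩ hK
    omega
  rw [hlongest, ← cs.longest_inv K, ← hlong, inv_mul_cancel_left]

end Automorphism

end Building

theorem theorem3 {B W C : Type*} [Group W] [Finite W] {M : CoxeterMatrix B}
    (cs : CoxeterSystem M W) (Δ : Building cs C) (hthick : Δ.IsThick)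
    (θ : Δ.Automorphism) (hcapped : θ.IsCapped) (J : Set B) (hJ : J = θ.type) :
    IsGreatest (Set.range fun x => Δ.galleryDist x (θ.onChamber x)) θ.disp ∧
      (θ.disp : ℤ) = (cs.diam : ℤ) - (cs.parabolicDiam Jᶜ : ℤ) ∧
      (θ.disp : ℤ) = (cs.length (cs.longest Set.univ) : ℤ) - (cs.length (cs.longest Jᶜ) : ℤ) ∧
      ∀ x : C,
        (Δ.galleryDist x (θ.onChamber x) = θ.disp ↔
          Δ.δ x (θ.onChamber x) = cs.longest Jᶜ * cs.longest Set.univ) ∧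
        (cs.length (Δ.δ x (θ.onChamber x)) = θ.disp ↔
          Δ.δ x (θ.onChamber x) = cs.longest Jᶜ * cs.longest Set.univ) := by
  subst hJ
  obtain ⟨x₀, hx₀⟩ := θ.exists_isMaxDisplaced
  have hgr : IsGreatest (Set.range fun x => Δ.galleryDist x (θ.onChamber x))
      (Δ.galleryDist x₀ (θ.onChamber x₀)) := by
    refine ⟨⟨x₀, rfl⟩, ?_⟩
    rintro _ ⟨y, rfl⟩
    simp only [Building.galleryDist_eq]
    exact hx₀ y
  -- The supremum defining `disp` would default to 0 on an unbounded set; the greatest element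
  -- excludes this.
  have hdisp : θ.disp = Δ.galleryDist x₀ (θ.onChamber x₀) := hgr.csSup_eq
  have hlen := cs.length_longest_mul_longest_univ θ.typeᶜ
  have hdisp' : θ.disp =
      cs.length (cs.longest θ.typeᶜ * cs.longest Set.univ) := by
    rw [hdisp, Building.galleryDist_eq, hx₀.δ_eq hthick hcapped]
  have hiff : ∀ x, cs.length (Δ.δ x (θ.onChamber x)) = θ.disp ↔
      Δ.δ x (θ.onChamber x) = cs.longest θ.typeᶜ * cs.longest Set.univ := by
    intro x
    constructor
    · intro h
      refine Building.Automorphism.IsMaxDisplaced.δ_eq hthick hcapped fun y => ?_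
      rw [h, hdisp, Building.galleryDist_eq]
      exact hx₀ y
    · intro h
      rw [h, hdisp']
  refine ⟨hdisp ▸ hgr, ?_, ?_, fun x => ⟨?_, hiff x⟩⟩
  · rw [cs.diam_eq, cs.parabolicDiam_eq]
    omega
  · omega
  · rw [Building.galleryDist_eq]
    exact hiff x
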